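/- Let $\mathcal A=M_2(\mathbb C)*M_2(\mathbb C)$ be the universal (full, unital) free product C*-algebra of two copies of $M_2(\mathbb C)$, with canonical unital $*$-homomorphisms $\iota_1,\iota_2\colon M_2(\mathbb C)\to\mathcal A$ onto the subalgebras $M_2(\mathbb C)*1$ and $1*M_2(\mathbb C)$. Let $A,B\in M_2(\mathbb C)$ satisfy $\operatorname{Tr}(A)=\operatorname{Tr}(B)=0$. Then the spectrum of $\iota_1(A)\iota_2(B)$ in $\mathcal A$ is $$\sigma\big(\iota_1(A)\iota_2(B)\big)=\Big\{re^{i\theta}:\ \|A^{-1}\|^{-1}\|B^{-1}\|^{-1}\le r\le \|A\|\,\|B\|,\ 0\le\theta\le 2\pi\Big\},$$ where $\|\cdot\|$ is the operator norm, with the conventions $\|X^{-1}\|=\infty$ if the matrix $X$ is not invertible, and $\infty^{-1}=0$. -/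

import Mathlib

open scoped ENNReal Matrix.Norms.L2Operator

noncomputable section

universe u v

/-- A *joint representation* of two unital C⋆-algebras `𝒜` and `ℬ`: a nonzero unital C⋆-algebra
`D` together with unital ⋆-homomorphisms `𝒜 → D` and `ℬ → D`. -/
structure JointRep (𝒜 ℬ : Type u) [CStarAlgebra 𝒜] [CStarAlgebra ℬ] : Type (u + 1) where
  D : Type u
  [isCStarAlgebra : CStarAlgebra D]
  [isNontrivial : Nontrivial D]
  left : 𝒜 →⋆ₐ[ℂ] D
  right : ℬ →⋆ₐ[ℂ] D

namespace JointRep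

variable {𝒜 ℬ : Type u} [CStarAlgebra 𝒜] [CStarAlgebra ℬ]

instance (ρ : JointRep 𝒜 ℬ) : CStarAlgebra ρ.D := ρ.isCStarAlgebra

instance (ρ : JointRep 𝒜 ℬ) : Nontrivial ρ.D := ρ.isNontrivial

end JointRep

namespace CStarFreeProduct

/-- The C⋆-algebra `∏ D_i` (bounded families, supremum norm) of a family of nonzero unital
C⋆-algebras. -/
instance instCStarAlgebraLp {I : Type v} {D : I → Type u} [∀ i, CStarAlgebra (D i)]
    [∀ i, Nontrivial (D i)] : CStarAlgebra (lp D ∞) where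

/-- The unital ⋆-homomorphism into a product `∏ D_i` whose coordinates are given unital
⋆-homomorphisms. -/
def toProd {I : Type v} {D : I → Type u} [∀ i, CStarAlgebra (D i)] [∀ i, Nontrivial (D i)]
    {𝒜 : Type u} [CStarAlgebra 𝒜] (f : ∀ i, 𝒜 →⋆ₐ[ℂ] D i) : 𝒜 →⋆ₐ[ℂ] lp D ∞ where
  toFun a := ⟨fun i => f i a, memℓp_infty ⟨‖a‖, by
    rintro _ ⟨i, rfl⟩
    exact NonUnitalStarAlgHom.norm_apply_le (f i) a⟩⟩
  map_one' := by ext i; simp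
  map_mul' a b := by ext i; simp
  map_zero' := by ext i; simp
  map_add' a b := by ext i; exact map_add (f i) a b
  commutes' c := by ext i; exact AlgHomClass.commutes (f i) c
  map_star' a := by ext i; simp [map_star]

/-- The ⋆-homomorphism from `∏ D_i` onto the coordinate `i`. -/
def evalProd {I : Type v} {D : I → Type u} [∀ i, CStarAlgebra (D i)] [∀ i, Nontrivial (D i)]
    (i : I) : lp D ∞ →⋆ₐ[ℂ] D i where
  toFun x := x i
  map_one' := by simp
  map_mul' a b := by simp
  map_zero' := by simp
  map_add' a b := by simp
  commutes' c := by rfl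
  map_star' a := by simp

variable (𝒜 ℬ : Type u) [CStarAlgebra 𝒜] [CStarAlgebra ℬ]

/-- The product of all joint representations of `𝒜` and `ℬ`. -/
abbrev Ambient : Type (u + 1) := lp (fun ρ : JointRep 𝒜 ℬ => ρ.D) ∞

/-- The copy of `𝒜` in the product of all joint representations. -/
def ambientLeft : 𝒜 →⋆ₐ[ℂ] Ambient 𝒜 ℬ := toProd fun ρ : JointRep 𝒜 ℬ => ρ.left

/-- The copy of `ℬ` in the product of all joint representations. -/
def ambientRight : ℬ →⋆ₐ[ℂ] Ambient 𝒜 ℬ := toProd fun ρ : JointRep 𝒜 ℬ => ρ.right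

end CStarFreeProduct

open CStarFreeProduct in
/-- The universal (full, unital) free product C⋆-algebra `𝒜 * ℬ`: the C⋆-subalgebra generated by
the copies of `𝒜` and `ℬ` in the product of all their joint representations. Restricting the
joint representations to the universe of `𝒜` and `ℬ` loses nothing, because the C⋆-subalgebra
generated by the images of `𝒜` and `ℬ` in any C⋆-algebra has an isomorphic copy there. -/
def CStarFreeProduct (𝒜 ℬ : Type u) [CStarAlgebra 𝒜] [CStarAlgebra ℬ] : Type (u + 1) :=
  (StarAlgebra.adjoin ℂ
    (Set.range (ambientLeft 𝒜 ℬ) ∪ Set.range (ambientRight 𝒜 ℬ))).topologicalClosure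

namespace CStarFreeProduct

variable {𝒜 ℬ : Type u} [CStarAlgebra 𝒜] [CStarAlgebra ℬ]

instance : CStarAlgebra (CStarFreeProduct 𝒜 ℬ) :=
  StarSubalgebra.cstarAlgebra _ (h_closed := StarSubalgebra.isClosed_topologicalClosure _)

/-- The inclusion of the free product in the product of all joint representations. -/
def val : CStarFreeProduct 𝒜 ℬ →⋆ₐ[ℂ] Ambient 𝒜 ℬ :=
  StarSubalgebra.subtype _

/-- The canonical map `𝒜 → 𝒜 * ℬ`, with range `𝒜 * 1`. -/
def inl : 𝒜 →⋆ₐ[ℂ] CStarFreeProduct 𝒜 ℬ :=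
  StarAlgHom.codRestrict (ambientLeft 𝒜 ℬ) _ fun a =>
    StarSubalgebra.le_topologicalClosure _
      (StarAlgebra.subset_adjoin ℂ _ (Or.inl (Set.mem_range_self a)))

/-- The canonical map `ℬ → 𝒜 * ℬ`, with range `1 * ℬ`. -/
def inr : ℬ →⋆ₐ[ℂ] CStarFreeProduct 𝒜 ℬ :=
  StarAlgHom.codRestrict (ambientRight 𝒜 ℬ) _ fun b =>
    StarSubalgebra.le_topologicalClosure _
      (StarAlgebra.subset_adjoin ℂ _ (Or.inr (Set.mem_range_self b)))

/-- The universal property of the free product. -/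
theorem existsUnique_lift {D : Type u} [CStarAlgebra D] [Nontrivial D]
    (f : 𝒜 →⋆ₐ[ℂ] D) (g : ℬ →⋆ₐ[ℂ] D) :
    ∃! φ : CStarFreeProduct 𝒜 ℬ →⋆ₐ[ℂ] D, φ.comp inl = f ∧ φ.comp inr = g := by
  refine ⟨(evalProd (⟨D, f, g⟩ : JointRep 𝒜 ℬ)).comp val, ⟨rfl, rfl⟩, ?_⟩
  rintro ψ ⟨hf, hg⟩
  have hcont (χ : CStarFreeProduct 𝒜 ℬ →⋆ₐ[ℂ] D) : Continuous χ :=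
    AddMonoidHomClass.continuous_of_bound χ 1 fun x => by
      simpa using NonUnitalStarAlgHom.norm_apply_le χ x
  refine StarAlgHom.ext_topologicalClosure (S := StarAlgebra.adjoin ℂ
    (Set.range (ambientLeft 𝒜 ℬ) ∪ Set.range (ambientRight 𝒜 ℬ)))
    (hcont ψ) (hcont _) ?_
  refine StarAlgHom.ext_adjoin ?_
  rintro ⟨_, _⟩ (⟨a, rfl⟩ | ⟨b, rfl⟩)
  · exact DFunLike.congr_fun hf a
  · exact DFunLike.congr_fun hg b

end CStarFreeProduct

/-- `‖A⁻¹‖` (operator norm) as an extended real: `∞` if the matrix `A` is not invertible. -/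
def invNorm (A : Matrix (Fin 2) (Fin 2) ℂ) : ℝ≥0∞ :=
  open Classical in if IsUnit A then ENNReal.ofReal ‖A⁻¹‖ else ∞

/-- The polar set product `R ×ₚ Θ = {r e^{iθ} : r ∈ R, θ ∈ Θ}`. -/
def polarProd (R Θ : Set ℝ) : Set ℂ :=
  {z | ∃ r ∈ R, ∃ θ ∈ Θ, z = r * Complex.exp (θ * Complex.I)}

end

/-!
The spectrum lies in the annulus for any two unital ⋆-homomorphisms `f`, `g` from `M₂(ℂ)` to a
C⋆-algebra: `‖f(A) g(B)‖ ≤ ‖A‖ ‖B‖`, and the same bound for `(f(A) g(B))⁻¹ = g(B⁻¹) f(A⁻¹)` gives the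
inner radius (`norm_le_of_mem_spectrum`, `le_norm_of_mem_spectrum`).

Conversely, representations of the free product on `ℂ²` suffice. For a unitary `W` the pair
`X ↦ X`, `X ↦ W X W⋆` extends to the free product, so that every eigenvalue of `A (W B W⋆)` lies in
the spectrum (`spectrum_subset_freeProduct`). Up to phases and unitary equivalence, the trace-zero
matrices `A` and `B` are antidiagonal with entries `a ≥ b ≥ 0` and `c ≥ d ≥ 0`, their singular values
(`exists_normal_form`). The determinant of `A (T B T⋆)` is `abcd`, so a nonzero `l` is an eigenvalue
exactly when the trace is `l + abcd / l`. For `T` in `SU(2)` with real diagonal entry `√k` the trace is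
`k (ad + bc) + (1 - k) (ac e + bd ē)` with `e` an arbitrary point of the unit circle. The points
`ac e + bd ē` form an ellipse and `ad + bc` lies inside it, so these segments sweep out the whole
elliptical disc (`exists_trace_eq`). The numbers `l + abcd / l` with `|l|` fixed form a confocal
ellipse, which lies in this disc as soon as `bd ≤ |l| ≤ ac` (`exists_unitary_mem_spectrum`).
-/

open Matrix

local notation "M₂" => Matrix (Fin 2) (Fin 2) ℂ

/-! ### Unitary `2 × 2` matrices and antidiagonal matrices -/

/-- The element of `SU(2)` with first row `x, y`, for `|x|² + |y|² = 1`. -/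
def specialUnitary (x y : ℂ) : M₂ := !![x, y; -star y, star x]

/-- The matrix with zero diagonal and off-diagonal entries `a` (upper right) and `b`
(lower left). -/
def antidiag (a b : ℂ) : M₂ := !![0, a; b, 0]

theorem star_specialUnitary (x y : ℂ) :
    star (specialUnitary x y) = !![star x, -y; star y, x] := by
  ext i j
  fin_cases i <;> fin_cases j <;> simp [specialUnitary, star_apply]

theorem specialUnitary_mem {x y : ℂ} (h : x * star x + y * star y = 1) :
    specialUnitary x y ∈ unitary M₂ := by
  rw [Unitary.mem_iff, star_specialUnitary]
  constructor <;>
  · ext i j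
    fin_cases i <;> fin_cases j <;> simp [specialUnitary] <;>
      simp at h <;> first | linear_combination h | ring

theorem complex_mul_star (z : ℂ) : z * star z = ((‖z‖ ^ 2 : ℝ) : ℂ) := by
  simpa using Complex.mul_conj' z

/-! ### Unitary equivalence up to a phase and the normal form -/

/-- `A` is a phase times a unitary conjugate of `B`. -/
def PhaseConj (A B : M₂) : Prop :=
  ∃ u : ℂ, ‖u‖ = 1 ∧ ∃ U : unitary M₂, A = u • (U * B * star (U : M₂))

theorem PhaseConj.trans {A B C : M₂} (h : PhaseConj A B)
    (h' : PhaseConj B C) : PhaseConj A C := by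
  obtain ⟨u, hu, U, rfl⟩ := h
  obtain ⟨v, hv, V, rfl⟩ := h'
  refine ⟨u * v, by simp [hu, hv], U * V, ?_⟩
  simp [mul_assoc, smul_smul]

/-- Some real line in `ℂ` is mapped into `ℝ` by the real-linear map `w ↦ q w + r w̄`: the imaginary
part of this map is a real functional on a plane, so it has a kernel. -/
theorem exists_real_direction (q r : ℂ) :
    ∃ w : ℂ, w ≠ 0 ∧ ∃ m : ℝ, q * w + r * star w = m := by
  suffices h : ∃ w : ℂ, w ≠ 0 ∧ (q * w + r * star w).im = 0 by
    obtain ⟨w, hw, h⟩ := h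
    exact ⟨w, hw, (q * w + r * star w).re, Complex.ext (by simp) (by simpa using h)⟩
  by_cases h : q.im + r.im = 0
  · exact ⟨1, one_ne_zero, by simpa using h⟩
  · refine ⟨⟨q.re - r.re, -(q.im + r.im)⟩, fun h0 => h ?_, ?_⟩
    · simpa using congrArg (fun z => -Complex.im z) h0
    · simp; ring

/-- The numerical range of a trace-zero matrix `!![p, q; r, -p]` contains `0`: the quadratic form
vanishes on some vector `(1, z)`, provided `p ≠ 0`. -/
theorem exists_isotropic {p : ℂ} (hp : p ≠ 0) (q r : ℂ) :
    ∃ z : ℂ, p * (1 - z * star z) + q * z + r * star z = 0 := by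
  obtain ⟨w, hw, m, hm⟩ := exists_real_direction (q / p) (r / p)
  -- Along the real line through `w` the form is `p` times a real quadratic polynomial.
  obtain ⟨τ, hτ⟩ : ∃ τ : ℝ, 1 - τ ^ 2 * ‖w‖ ^ 2 + τ * m = 0 := by
    have hs : Real.sqrt (m ^ 2 + 4 * ‖w‖ ^ 2) ^ 2 = m ^ 2 + 4 * ‖w‖ ^ 2 :=
      Real.sq_sqrt (by positivity)
    refine ⟨(m + Real.sqrt (m ^ 2 + 4 * ‖w‖ ^ 2)) / (2 * ‖w‖ ^ 2), ?_⟩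
    field_simp
    linear_combination -hs
  refine ⟨τ * w, ?_⟩
  have hτ' : (1 : ℂ) - τ ^ 2 * (‖w‖ : ℂ) ^ 2 + τ * m = 0 := by exact_mod_cast hτ
  have hw' := complex_mul_star w
  push_cast at hw'
  have hm' : q * w + r * star w = m * p := by
    rw [← hm]; field_simp
  simp at hw' hm' ⊢
  linear_combination p * hτ' + τ * hm' - p * τ ^ 2 * hw'

/-- A trace-zero matrix has zero diagonal in a suitable orthonormal basis: the first vector spans
the line of `(1, z)` on which the quadratic form vanishes, and the second diagonal entry is then the
trace. -/
theorem exists_antidiag {A : M₂} (hA : A.trace = 0) :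
    ∃ a b : ℂ, PhaseConj A (antidiag a b) := by
  obtain ⟨p, q, r, rfl⟩ : ∃ p q r, A = !![p, q; r, -p] := by
    refine ⟨A 0 0, A 0 1, A 1 0, ?_⟩
    rw [trace_fin_two] at hA
    ext i j
    fin_cases i <;> fin_cases j <;> simp
    linear_combination hA
  by_cases hp : p = 0
  · exact ⟨q, r, 1, by simp, 1, by simp [hp, antidiag]⟩
  obtain ⟨z, hz⟩ := exists_isotropic hp q r
  set n : ℝ := (Real.sqrt (1 + ‖z‖ ^ 2))⁻¹ with hn
  have hn2 : n ^ 2 * (1 + ‖z‖ ^ 2) = 1 := by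
    rw [hn, inv_pow, Real.sq_sqrt (by positivity)]
    field_simp
  have hn2' : (n : ℂ) ^ 2 * (1 + z * star z) = 1 := by
    rw [complex_mul_star]; exact_mod_cast hn2
  have hU : specialUnitary n (-(n * star z)) ∈ unitary M₂ := by
    apply specialUnitary_mem
    simp at hn2' ⊢
    linear_combination hn2'
  set U : unitary M₂ := ⟨_, hU⟩
  have key : star (U : M₂) * !![p, q; r, -p] * U =
      antidiag ((star (U : M₂) * !![p, q; r, -p] * U) 0 1)
        ((star (U : M₂) * !![p, q; r, -p] * U) 1 0) := by
    ext i j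
    fin_cases i <;> fin_cases j <;> simp [antidiag]
    · simp only [U, star_specialUnitary]
      simp [specialUnitary, mul_apply, Fin.sum_univ_two] at hz ⊢
      linear_combination (n : ℂ) ^ 2 * hz
    · simp only [U, star_specialUnitary]
      simp [specialUnitary, mul_apply, Fin.sum_univ_two] at hz ⊢
      linear_combination -(n : ℂ) ^ 2 * hz
  refine ⟨(star (U : M₂) * !![p, q; r, -p] * U) 0 1,
    (star (U : M₂) * !![p, q; r, -p] * U) 1 0, 1, by simp, U, ?_⟩
  rw [← key, one_smul]
  simp only [← mul_assoc, Unitary.mul_star_self_of_mem U.2, one_mul]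
  simp only [mul_assoc, Unitary.mul_star_self_of_mem U.2, mul_one]

theorem exists_phase (a : ℂ) : ∃ α : ℂ, ‖α‖ = 1 ∧ a = α * ‖a‖ :=
  ⟨Complex.exp (a.arg * Complex.I), Complex.norm_exp_ofReal_mul_I _, by
    rw [mul_comm, Complex.norm_mul_exp_arg_mul_I]⟩

theorem mul_star_of_norm_one {z : ℂ} (hz : ‖z‖ = 1) : z * star z = 1 := by
  rw [complex_mul_star, hz]; simp

theorem phaseConj_antidiag_norm (a b : ℂ) : PhaseConj (antidiag a b) (antidiag ‖a‖ ‖b‖) := by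
  obtain ⟨α, hα, ha⟩ := exists_phase a
  obtain ⟨β, hβ, hb⟩ := exists_phase b
  -- Conjugation by `diag(v, v̄)` multiplies the off-diagonal entries by `v²` and `v̄²`, and the
  -- remaining common phase is `u = α v̄² = β v²`.
  obtain ⟨v, hv⟩ := IsAlgClosed.exists_pow_nat_eq (α * star β) (n := 4) (by norm_num)
  have hv1 : ‖v‖ = 1 := by
    have := congrArg norm hv
    simp only [norm_pow, norm_mul, norm_star, hα, hβ, mul_one] at this
    exact (pow_eq_one_iff_of_nonneg (norm_nonneg v) (by norm_num)).1 this
  have hvv := mul_star_of_norm_one hv1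
  have hαα := mul_star_of_norm_one hα
  have hV : specialUnitary v 0 ∈ unitary M₂ :=
    specialUnitary_mem (by simpa using hvv)
  refine ⟨α * star v ^ 2, by simp [hα, hv1], ⟨_, hV⟩, ?_⟩
  simp only [star_specialUnitary]
  simp at hvv hαα hv
  have h4 : starRingEnd ℂ v ^ 4 * α = β := by
    have := congrArg (starRingEnd ℂ) hv
    simp at this
    rw [this]
    linear_combination β * hαα
  ext i j
  fin_cases i <;> fin_cases j <;> simp [antidiag, specialUnitary]
  · rw [ha]; simp [hα]
    linear_combination -(α * ‖a‖) * (v * starRingEnd ℂ v + 1) * hvv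
  · rw [hb]; simp [hβ]
    linear_combination -(‖b‖ : ℂ) * h4

theorem phaseConj_antidiag_swap (a b : ℂ) : PhaseConj (antidiag a b) (antidiag b a) := by
  refine ⟨-1, by simp, ⟨specialUnitary 0 1, specialUnitary_mem (by simp)⟩, ?_⟩
  simp only [star_specialUnitary]
  ext i j
  fin_cases i <;> fin_cases j <;> simp [antidiag, specialUnitary]

/-- Up to a phase and unitary equivalence, a trace-zero `2 × 2` matrix is determined by its
singular values. -/
theorem exists_normal_form {A : M₂} (hA : A.trace = 0) :
    ∃ a b : ℝ, 0 ≤ b ∧ b ≤ a ∧ PhaseConj A (antidiag a b) := by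
  obtain ⟨a, b, h⟩ := exists_antidiag hA
  have h := h.trans (phaseConj_antidiag_norm a b)
  rcases le_total ‖b‖ ‖a‖ with hab | hab
  · exact ⟨‖a‖, ‖b‖, norm_nonneg _, hab, h⟩
  · exact ⟨‖b‖, ‖a‖, norm_nonneg _, hab, h.trans (phaseConj_antidiag_swap _ _)⟩

/-! ### Norm and inverse of the normal form -/

theorem PhaseConj.norm_eq {A B : M₂} (h : PhaseConj A B) :
    ‖A‖ = ‖B‖ := by
  obtain ⟨u, hu, U, rfl⟩ := h
  rw [norm_smul, hu, one_mul, ← Unitary.coe_star, CStarRing.norm_mul_coe_unitary,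
    CStarRing.norm_coe_unitary_mul]

theorem PhaseConj.det_eq_zero_iff {A B : M₂} (h : PhaseConj A B) :
    A.det = 0 ↔ B.det = 0 := by
  obtain ⟨u, hu, U, rfl⟩ := h
  have hu0 : u ≠ 0 := by rintro rfl; simp at hu
  have h1 : (U : M₂).det * (star (U : M₂)).det = 1 := by
    rw [← det_mul, Unitary.mul_star_self_of_mem U.2, det_one]
  have h2 : (U * B * star (U : M₂)).det = B.det := by
    rw [det_mul, det_mul, mul_right_comm, h1, one_mul]
  rw [det_smul, h2]
  simp [hu0]

theorem PhaseConj.inv {A B : M₂} (h : PhaseConj A B) (hB : B.det ≠ 0) :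
    PhaseConj A⁻¹ B⁻¹ := by
  obtain ⟨u, hu, U, rfl⟩ := h
  have hu0 : u ≠ 0 := by rintro rfl; simp at hu
  refine ⟨u⁻¹, by simp [hu], U, inv_eq_right_inv ?_⟩
  have hUU := Unitary.star_mul_self_of_mem U.2
  have hBB := mul_nonsing_inv B (isUnit_iff_ne_zero.2 hB)
  have hcalc : U * B * star (U : M₂) * (U * B⁻¹ * star (U : M₂)) = 1 := by
    calc _ = U * B * (star (U : M₂) * U) * B⁻¹ *
          star (U : M₂) := by noncomm_ring
      _ = U * (B * B⁻¹) * star (U : M₂) := by rw [hUU]; noncomm_ring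
      _ = 1 := by rw [hBB, mul_one, Unitary.mul_star_self_of_mem U.2]
  rw [smul_mul_smul_comm, hcalc, mul_inv_cancel₀ hu0, one_smul]

theorem norm_antidiag {a b : ℝ} (hb : 0 ≤ b) (hab : b ≤ a) : ‖antidiag a b‖ = a := by
  have h : antidiag a b = specialUnitary 0 1 * diagonal ![-(b : ℂ), a] := by
    ext i j
    fin_cases i <;> fin_cases j <;> simp [antidiag, specialUnitary]
  rw [h]
  have := CStarRing.norm_coe_unitary_mul
    (⟨specialUnitary 0 1, specialUnitary_mem (by simp)⟩ : unitary M₂)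
    (diagonal ![-(b : ℂ), a])
  simp only at this
  rw [this, l2_opNorm_diagonal]
  apply le_antisymm
  · rw [pi_norm_le_iff_of_nonneg (hb.trans hab)]
    intro i
    fin_cases i <;> simp [abs_of_nonneg hb, abs_of_nonneg (hb.trans hab), hab]
  · simpa [abs_of_nonneg (hb.trans hab)] using norm_le_pi_norm ![-(b : ℂ), a] 1

theorem det_antidiag (a b : ℂ) : (antidiag a b).det = -(a * b) := by
  simp [antidiag, det_fin_two]

theorem inv_antidiag {a b : ℂ} (ha : a ≠ 0) (hb : b ≠ 0) :
    (antidiag a b)⁻¹ = antidiag b⁻¹ a⁻¹ := by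
  apply inv_eq_right_inv
  ext i j
  fin_cases i <;> fin_cases j <;> simp [antidiag, ha, hb]

/-- The smaller singular value of the normal form is `‖A⁻¹‖⁻¹`; for singular `A` both are `0`. -/
theorem invNorm_inv_toReal {A : M₂} {a b : ℝ} (hb : 0 ≤ b) (hab : b ≤ a)
    (h : PhaseConj A (antidiag a b)) : (invNorm A)⁻¹.toReal = b := by
  rcases hb.eq_or_lt with rfl | hb
  · have : ¬ IsUnit A := by
      rw [isUnit_iff_isUnit_det, isUnit_iff_ne_zero, not_not, h.det_eq_zero_iff, det_antidiag]
      simp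
    simp [invNorm, this]
  · have ha : 0 < a := hb.trans_le hab
    have hd : (antidiag (a : ℂ) b).det ≠ 0 := by
      rw [det_antidiag]; simp [ha.ne', hb.ne']
    have hU : IsUnit A := by
      rw [isUnit_iff_isUnit_det, isUnit_iff_ne_zero, Ne, h.det_eq_zero_iff]
      exact hd
    have hn : ‖A⁻¹‖ = b⁻¹ := by
      rw [(h.inv hd).norm_eq, inv_antidiag (by simp [ha.ne']) (by simp [hb.ne'])]
      have := norm_antidiag (inv_nonneg.2 ha.le) ((inv_le_inv₀ ha hb).2 hab)
      simpa using this
    simp [invNorm, hU, hn, hb.le]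

/-! ### Eigenvalues of `A (T B T⋆)` -/

/-- A point `z` of the closed unit disc lies on a segment from a given point `z₁` of the disc to
the unit circle. -/
theorem exists_chord {z z₁ : ℂ} (hz : ‖z‖ ≤ 1) (hz₁ : ‖z₁‖ ≤ 1) :
    ∃ k : ℝ, 0 ≤ k ∧ k ≤ 1 ∧ ∃ e : ℂ, ‖e‖ = 1 ∧ z = k * z₁ + (1 - k) * e := by
  by_cases h : z = z₁
  · exact ⟨1, by simp, le_rfl, 1, by simp, by simp [h]⟩
  have hd : 0 < ‖z - z₁‖ := norm_pos_iff.2 (sub_ne_zero.2 h)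
  have hd2 : ‖z - z₁‖ ≤ 2 := (norm_sub_le _ _).trans (by linarith)
  -- Move along the ray from `z₁` through `z` until it leaves the disc.
  have hc : ContinuousOn (fun t : ℝ => ‖z₁ + t * (z - z₁)‖) (Set.Icc 1 (2 / ‖z - z₁‖)) := by
    fun_prop
  have h2 : 1 ≤ ‖z₁ + ((2 / ‖z - z₁‖ : ℝ) : ℂ) * (z - z₁)‖ := by
    have h3 : ‖((2 / ‖z - z₁‖ : ℝ) : ℂ) * (z - z₁)‖ = 2 := by
      rw [norm_mul, Complex.norm_real, Real.norm_of_nonneg (by positivity)]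
      field_simp
    have := norm_sub_le_norm_add (((2 / ‖z - z₁‖ : ℝ) : ℂ) * (z - z₁)) z₁
    rw [h3, add_comm _ z₁] at this
    linarith
  obtain ⟨t, ht, hte⟩ := intermediate_value_Icc ((one_le_div hd).2 hd2) hc
    (show (1 : ℝ) ∈ _ from ⟨by simpa using hz, h2⟩)
  have ht0 : 0 < t := lt_of_lt_of_le one_pos ht.1
  refine ⟨1 - t⁻¹, by simpa using inv_le_one_of_one_le₀ ht.1, by simp [ht0.le], _, hte, ?_⟩
  have : (t : ℂ) ≠ 0 := by exact_mod_cast ht0.ne'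
  push_cast
  field_simp
  ring

theorem exists_mul_of_abs_le {X M : ℝ} (h : |X| ≤ M) : ∃ x : ℝ, |x| ≤ 1 ∧ X = M * x := by
  rcases ((abs_nonneg X).trans h).eq_or_lt with h0 | h0
  · refine ⟨0, by simp, ?_⟩
    rw [← h0] at h ⊢
    simpa using h
  · exact ⟨X / M, by rwa [abs_div, abs_of_pos h0, div_le_one h0], by field_simp⟩

theorem mem_spectrum_fin_two {M : M₂} {l : ℂ}
    (h : l ^ 2 - M.trace * l + M.det = 0) : l ∈ spectrum ℂ M := by
  rw [mem_spectrum_iff_isRoot_charpoly, charpoly_fin_two]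
  simpa [Polynomial.IsRoot] using h

/-- The trace of `A (T B T⋆)` for antidiagonal `A`, `B` and `T ∈ SU(2)` whose diagonal
is real. -/
theorem trace_antidiag_conj (a b c d s : ℂ) (C : ℝ) :
    (antidiag a b * (specialUnitary C s * antidiag c d * star (specialUnitary C s))).trace =
      C ^ 2 * (a * d + b * c) - (a * c * star s ^ 2 + b * d * s ^ 2) := by
  rw [star_specialUnitary, trace_fin_two]
  simp [antidiag, specialUnitary]
  ring

/-- The traces of the products `A (T B T⋆)`, for `A`, `B` antidiagonal with entries `a ≥ b ≥ 0` and
`c ≥ d ≥ 0`, fill the elliptical disc with half axes `ac + bd` and `ac - bd`. -/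
theorem exists_trace_eq {a b c d : ℝ} (hb : 0 ≤ b) (hab : b ≤ a) (hd : 0 ≤ d) (hcd : d ≤ c)
    {z : ℂ} (hz : ‖z‖ ≤ 1) :
    ∃ T : unitary M₂,
      (antidiag a b * (T * antidiag c d * star (T : M₂))).trace =
        a * c * z + b * d * star z := by
  -- `C = 1`, `s = 0` gives the trace `ad + bc`; it is the point `x` of the major axis.
  obtain ⟨x, hx, hxe⟩ : ∃ x : ℝ, |x| ≤ 1 ∧ a * d + b * c = (a * c + b * d) * x := by
    apply exists_mul_of_abs_le
    rw [abs_of_nonneg (by have := hb.trans hab; have := hd.trans hcd; positivity)]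
    nlinarith [mul_nonneg (sub_nonneg.2 hab) (sub_nonneg.2 hcd)]
  obtain ⟨k, hk0, hk1, e, he, rfl⟩ := exists_chord hz (z₁ := x) (by simpa using hx)
  -- The weights `k` and `1 - k` are `C²` and `|s|²`.
  obtain ⟨t, ht⟩ := IsAlgClosed.exists_pow_nat_eq (-((1 - k) * e)) (n := 2) (by norm_num)
  have htn : ‖t‖ ^ 2 = 1 - k := by
    rw [← norm_pow, ht, norm_neg, norm_mul, he, mul_one,
      show (1 - k : ℂ) = ((1 - k : ℝ) : ℂ) by push_cast; rfl, Complex.norm_real,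
      Real.norm_of_nonneg (by linarith)]
  have hC : ((Real.sqrt k : ℝ) : ℂ) ^ 2 = k := by exact_mod_cast Real.sq_sqrt hk0
  have hT : specialUnitary (Real.sqrt k) (star t) ∈ unitary M₂ := by
    apply specialUnitary_mem
    have h1 := complex_mul_star t
    rw [htn] at h1
    simp at h1 ⊢
    linear_combination hC + h1
  refine ⟨⟨_, hT⟩, ?_⟩
  simp only
  rw [trace_antidiag_conj, hC, star_star, ht]
  have ht' := congrArg star ht
  have hxe' : (a * d + b * c : ℂ) = (a * c + b * d) * x := by exact_mod_cast hxe
  simp at ht' ⊢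
  rw [ht']
  linear_combination (k : ℂ) * hxe'

/-- For `A`, `B` in normal form, every point of the annulus is an eigenvalue of
`A (T B T⋆)` for a suitable unitary `T`. -/
theorem exists_unitary_mem_spectrum {a b c d : ℝ} (hb : 0 ≤ b) (hab : b ≤ a) (hd : 0 ≤ d)
    (hcd : d ≤ c) {l : ℂ} (h1 : b * d ≤ ‖l‖) (h2 : ‖l‖ ≤ a * c) :
    ∃ T : unitary M₂, l ∈ spectrum ℂ
      (antidiag a b * (T * antidiag c d * star (T : M₂))) := by
  have hdet (T : unitary M₂) :
      (antidiag a b * (T * antidiag c d * star (T : M₂))).det =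
        a * b * c * d := by
    have h : (T : M₂).det * (star (T : M₂)).det = 1 := by
      rw [← det_mul, Unitary.mul_star_self_of_mem T.2, det_one]
    rw [det_mul, det_mul, det_mul, det_antidiag, det_antidiag]
    linear_combination (a * b * c * d : ℂ) * h
  rcases eq_or_ne l 0 with rfl | hl
  · have hbd : b * d = 0 := le_antisymm (by simpa using h1) (by positivity)
    have hbd' : (b * d : ℂ) = 0 := by exact_mod_cast hbd
    refine ⟨1, mem_spectrum_fin_two ?_⟩
    rw [hdet]
    linear_combination (a * c : ℂ) * hbd'
  obtain ⟨e, he, hle⟩ := exists_phase l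
  have hr : 0 < ‖l‖ := norm_pos_iff.2 hl
  set r := ‖l‖
  have ha := hb.trans hab
  have hc := hd.trans hcd
  -- The eigenvalue equation asks for the trace `l + abcd / l`, whose coordinates along the axes of
  -- the ellipse are `X = r + abcd / r` and `Y = r - abcd / r` times those of `e`.
  set δ := a * b * c * d / r
  have hδr : δ * r = (a * c) * (b * d) := by simp only [δ]; field_simp
  have hδ0 : 0 ≤ δ := by positivity
  have hbdac : b * d ≤ a * c := by gcongr
  have hδ1 : b * d ≤ δ := by
    by_contra! hlt
    nlinarith [mul_nonneg hb hd]
  have hδ2 : δ ≤ a * c := by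
    simp only [δ]
    rw [div_le_iff₀ hr]
    nlinarith [mul_nonneg ha hc]
  obtain ⟨x, hx, hX⟩ : ∃ x : ℝ, |x| ≤ 1 ∧ r + δ = (a * c + b * d) * x := by
    apply exists_mul_of_abs_le
    rw [abs_of_nonneg (by positivity)]
    nlinarith [mul_nonneg (sub_nonneg.2 h1) (sub_nonneg.2 h2)]
  obtain ⟨y, hy, hY⟩ : ∃ y : ℝ, |y| ≤ 1 ∧ r - δ = (a * c - b * d) * y := by
    apply exists_mul_of_abs_le
    rw [abs_le]
    constructor <;> linarith
  obtain ⟨T, hT⟩ := exists_trace_eq hb hab hd hcd (z := ⟨x * e.re, y * e.im⟩) (by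
    rw [← sq_le_one_iff₀ (norm_nonneg _), ← Complex.normSq_eq_norm_sq, Complex.normSq_mk]
    have h3 : e.re * e.re + e.im * e.im = 1 := by
      rw [← Complex.normSq_apply, Complex.normSq_eq_norm_sq, he, one_pow]
    have hx2 := (sq_le_one_iff_abs_le_one x).2 hx
    have hy2 := (sq_le_one_iff_abs_le_one y).2 hy
    nlinarith [mul_nonneg (sub_nonneg.2 hx2) (mul_self_nonneg e.re),
      mul_nonneg (sub_nonneg.2 hy2) (mul_self_nonneg e.im)])
  refine ⟨T, mem_spectrum_fin_two ?_⟩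
  have htr : (a * c * (⟨x * e.re, y * e.im⟩ : ℂ) + b * d * star (⟨x * e.re, y * e.im⟩ : ℂ) : ℂ) =
      r * e + δ * star e := by
    apply Complex.ext <;> simp
    · linear_combination -e.re * hX
    · linear_combination -e.im * hY
  rw [hT, hdet, htr, hle]
  have hee := mul_star_of_norm_one he
  have hδr' : (δ * r : ℂ) = (a * c) * (b * d) := by exact_mod_cast hδr
  linear_combination -(δ * r : ℂ) * hee - hδr'

theorem spectrum_phase_smul {M : M₂} {u l : ℂ} (hu : u ≠ 0)
    (h : u⁻¹ * l ∈ spectrum ℂ M) : l ∈ spectrum ℂ (u • M) := by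
  have := spectrum.unit_smul_eq_smul (R := ℂ) M (Units.mk0 u hu)
  rw [show u • M = Units.mk0 u hu • M from rfl, this]
  exact ⟨_, h, by simp [hu]⟩

theorem PhaseConj.exists_unitary_mem_spectrum {A B : M₂} {a b c d : ℝ}
    (hA : PhaseConj A (antidiag a b)) (hB : PhaseConj B (antidiag c d))
    (hb : 0 ≤ b) (hab : b ≤ a) (hd : 0 ≤ d) (hcd : d ≤ c) {l : ℂ}
    (h1 : b * d ≤ ‖l‖) (h2 : ‖l‖ ≤ a * c) :
    ∃ W : unitary M₂, l ∈ spectrum ℂ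
      (A * (W * B * star (W : M₂))) := by
  obtain ⟨u, hu, U, rfl⟩ := hA
  obtain ⟨v, hv, V, rfl⟩ := hB
  have huv : ‖u * v‖ = 1 := by simp [hu, hv]
  have huv0 : u * v ≠ 0 := by intro h; simp [h] at huv
  have hl : ‖(u * v)⁻¹ * l‖ = ‖l‖ := by rw [norm_mul, norm_inv, huv]; simp
  obtain ⟨T, hT⟩ := _root_.exists_unitary_mem_spectrum hb hab hd hcd (hl.symm ▸ h1) (hl.symm ▸ h2)
  refine ⟨U * T * star V, ?_⟩
  rw [← Unitary.spectrum_star_right_conjugate (U := U)] at hT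
  have := spectrum_phase_smul huv0 hT
  convert this using 2
  have hUU := Unitary.star_mul_self_of_mem U.2
  have hVV := Unitary.star_mul_self_of_mem V.2
  simp only [Submonoid.coe_mul, Unitary.coe_star, star_mul, star_star, mul_smul_comm, smul_mul_assoc,
    smul_smul, mul_comm v u]
  congr 1
  calc _ = U * antidiag a b * (star (U : M₂) * U) * T *
        (star (V : M₂) * V) * antidiag c d *
        (star (V : M₂) * V) * star (T : M₂) *
        star (U : M₂) := by noncomm_ring
    _ = _ := by rw [hUU, hVV]; noncomm_ring

/-! ### The spectrum in the free product -/

open CStarFreeProduct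

instance CStarFreeProduct.instNontrivial :
    Nontrivial (CStarFreeProduct M₂ M₂) :=
  ((existsUnique_lift (StarAlgHom.id ℂ M₂)
    (StarAlgHom.id ℂ _)).choose : _ →+* M₂).domain_nontrivial

/-- The pair `X ↦ X`, `X ↦ W X W⋆` is a joint representation on `ℂ²`, and unital homomorphisms
shrink spectra. -/
theorem spectrum_subset_freeProduct (A B : M₂)
    (W : unitary M₂) :
    spectrum ℂ (A * (W * B * star (W : M₂))) ⊆
      spectrum ℂ (inl A * inr B :
        CStarFreeProduct M₂ M₂) := by
  obtain ⟨φ, ⟨hl, hr⟩, -⟩ := existsUnique_lift (StarAlgHom.id ℂ M₂)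
    (Unitary.conjStarAlgAut ℂ M₂ W).toStarAlgHom
  have hl' : φ (inl A) = A := DFunLike.congr_fun hl A
  have hr' : φ (inr B) = W * B * star (W : M₂) := by
    simpa using DFunLike.congr_fun hr B
  have h := AlgHom.spectrum_apply_subset φ (inl A * inr B)
  rwa [map_mul, hl', hr'] at h

theorem norm_le_of_mem_spectrum {D : Type*} [CStarAlgebra D] [Nontrivial D]
    (f g : M₂ →⋆ₐ[ℂ] D) {A B : M₂} {l : ℂ}
    (hl : l ∈ spectrum ℂ (f A * g B)) : ‖l‖ ≤ ‖A‖ * ‖B‖ :=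
  (spectrum.norm_le_norm_of_mem hl).trans <| (norm_mul_le _ _).trans <|
    mul_le_mul (NonUnitalStarAlgHom.norm_apply_le f A) (NonUnitalStarAlgHom.norm_apply_le g B)
      (norm_nonneg _) (norm_nonneg _)

/-- The lower bound is the upper bound for the inverse `g(B⁻¹) f(A⁻¹)` of `f(A) g(B)`; if `A` or `B`
is singular it is `0`. -/
theorem le_norm_of_mem_spectrum {D : Type*} [CStarAlgebra D] [Nontrivial D]
    (f g : M₂ →⋆ₐ[ℂ] D) {A B : M₂} {l : ℂ}
    (hl : l ∈ spectrum ℂ (f A * g B)) : ((invNorm A)⁻¹ * (invNorm B)⁻¹).toReal ≤ ‖l‖ := by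
  by_cases hA : IsUnit A
  swap
  · simp [invNorm, hA]
  by_cases hB : IsUnit B
  swap
  · simp [invNorm, hB]
  obtain ⟨A, rfl⟩ := hA
  obtain ⟨B, rfl⟩ := hB
  let x : Dˣ := Units.map (f : M₂ →* D) A *
    Units.map (g : M₂ →* D) B
  have hl' : l ∈ spectrum ℂ (x : D) := hl
  have hl0 : l ≠ 0 := spectrum.ne_zero_of_mem_of_unit hl'
  have hinv : l⁻¹ ∈ spectrum ℂ ((x⁻¹ : Dˣ) : D) := spectrum.inv₀_mem_inv_iff.2 hl'
  have hx : ((x⁻¹ : Dˣ) : D) = g (B⁻¹ : M₂ˣ) *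
      f (A⁻¹ : M₂ˣ) := by
    rw [show x⁻¹ = _ from _root_.mul_inv_rev _ _, ← map_inv, ← map_inv]
    rfl
  rw [hx] at hinv
  have h := norm_le_of_mem_spectrum g f hinv
  rw [norm_inv, coe_units_inv, coe_units_inv] at h
  simp only [invNorm, Units.isUnit, if_true, ENNReal.toReal_mul, ENNReal.toReal_inv,
    ENNReal.toReal_ofReal (norm_nonneg _)]
  rw [← mul_inv, mul_comm]
  exact inv_le_of_inv_le₀ (norm_pos_iff.2 hl0) h

theorem mem_polarProd_iff {R : Set ℝ} (hR : ∀ r ∈ R, 0 ≤ r) {z : ℂ} :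
    z ∈ polarProd R (Set.Icc 0 (2 * Real.pi)) ↔ ‖z‖ ∈ R := by
  constructor
  · rintro ⟨r, hr, θ, -, rfl⟩
    rwa [norm_mul, Complex.norm_exp_ofReal_mul_I, mul_one, Complex.norm_real,
      Real.norm_of_nonneg (hR r hr)]
  · intro h
    refine ⟨‖z‖, h, toIcoMod Real.two_pi_pos 0 z.arg, ?_, ?_⟩
    · have := toIcoMod_mem_Ico Real.two_pi_pos 0 z.arg
      rw [zero_add] at this
      exact Set.Ico_subset_Icc_self this
    · conv_lhs => rw [← Complex.norm_mul_exp_arg_mul_I z]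
      congr 1
      rw [Complex.exp_eq_exp_iff_exists_int]
      refine ⟨toIcoDiv Real.two_pi_pos 0 z.arg, ?_⟩
      have := toIcoMod_add_toIcoDiv_zsmul Real.two_pi_pos 0 z.arg
      conv_lhs => rw [← this]
      push_cast
      simp
      ring

theorem theorem3p6 (A B : Matrix (Fin 2) (Fin 2) ℂ) (hA : A.trace = 0) (hB : B.trace = 0) :
    spectrum ℂ (CStarFreeProduct.inl A * CStarFreeProduct.inr B :
        CStarFreeProduct (Matrix (Fin 2) (Fin 2) ℂ) (Matrix (Fin 2) (Fin 2) ℂ)) =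
      polarProd (Set.Icc ((invNorm A)⁻¹ * (invNorm B)⁻¹).toReal (‖A‖ * ‖B‖))
        (Set.Icc 0 (2 * Real.pi)) := by
  ext l
  rw [mem_polarProd_iff fun r hr => ENNReal.toReal_nonneg.trans hr.1]
  refine ⟨fun hl => ⟨le_norm_of_mem_spectrum _ _ hl, norm_le_of_mem_spectrum _ _ hl⟩,
    fun ⟨h1, h2⟩ => ?_⟩
  obtain ⟨a, b, hb, hab, hAn⟩ := exists_normal_form hA
  obtain ⟨c, d, hd, hcd, hBn⟩ := exists_normal_form hB
  rw [ENNReal.toReal_mul, invNorm_inv_toReal hb hab hAn, invNorm_inv_toReal hd hcd hBn] at h1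
  rw [hAn.norm_eq, hBn.norm_eq, norm_antidiag hb hab, norm_antidiag hd hcd] at h2
  obtain ⟨W, hW⟩ := hAn.exists_unitary_mem_spectrum hBn hb hab hd hcd h1 h2
  exact spectrum_subset_freeProduct A B W hW
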